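/- Let $d\ge 1$, let $Q,K,V$ be real $d\times d$ matrices with $Q$ and $K$ invertible, and put $P_xy:=y-\langle x,y\rangle x$ for $x\in\mathbb S^{d-1}$, $y\in\mathbb R^d$. Let $\mu_0$ be a probability measure on the unit sphere $\mathbb S^{d-1}\subset\mathbb R^d$ that is absolutely continuous with respect to the Lebesgue (surface) measure, and let $(\mu_t)_{t\ge 0}$ be a weak solution with initial datum $\mu_0$ of $$\partial_t\mu=-\operatorname{div}\big(\mu\, b\big)\quad\text{on }\mathbb S^{d-1},\qquad b(x):=P_x\frac{VK^\top Qx}{|K^\top Qx|},$$ that is, $t\mapsto\mu_t$ is a weakly continuous curve of probability measures on $\mathbb S^{d-1}$ which equals $\mu_0$ at $t=0$, and for every smooth function $\varphi:\mathbb R^d\to\mathbb R$ and every $t\ge 0$ $$\int\varphi\,d\mu_t=\int\varphi\,d\mu_0+\int_0^t\int\langle\nabla\varphi(x),b(x)\rangle\,d\mu_s(x)\,ds .$$ Let $\omega(\mu_0)$ be the set of all weak limits of sequences $\mu_{t_k}$ with $t_k\to\infty$. Then every $\nu\in\omega(\mu_0)$ satisfies $$\operatorname{supp}(\nu)\subseteq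 E_{\max}\cap\mathbb S^{d-1},$$ where $E_{\max}\subseteq\mathbb R^d$ is the generalized eigenspace of $VK^\top Q$ for the eigenvalues with the largest real part, i.e. the set of real vectors that lie in the sum of the generalized eigenspaces in $\mathbb C^d$ of $VK^\top Q$ over all its complex eigenvalues of maximal real part. -/

import Mathlib

open MeasureTheory Filter Topology Set
open scoped ContDiff InnerProductSpace

noncomputable section

namespace Alignment

/-- The Euclidean space `ℝ^d`. -/
abbrev E (d : ℕ) : Type := EuclideanSpace ℝ (Fin d)

/-- The unit sphere `S^{d-1}` of `ℝ^d`. -/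
abbrev Sph (d : ℕ) : Type := Metric.sphere (0 : E d) 1

/-- The Lebesgue (surface) measure on `S^{d-1}`. -/
def surfaceMeasure (d : ℕ) : Measure (Sph d) := (volume : Measure (E d)).toSphere

/-- The orthogonal projection `P_x y = y - ⟨x, y⟩ x` onto the tangent space of the sphere at `x`. -/
def tangentProj {d : ℕ} (x y : E d) : E d := y - ⟪x, y⟫_ℝ • x

/-- The vector field `x ↦ P_x (V Kᵀ Q x / |Kᵀ Q x|)`. -/
def field {d : ℕ} (Q K V : Matrix (Fin d) (Fin d) ℝ) (x : E d) : E d :=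
  tangentProj x (‖Matrix.toEuclideanLin (K.transpose * Q) x‖⁻¹ •
    Matrix.toEuclideanLin (V * K.transpose * Q) x)

/-- `μ` is a (measure-valued, weakly continuous, distributional) solution on `[0, ∞) × S^{d-1}` of
`∂_t μ + div (μ P_x (V Kᵀ Q x / |Kᵀ Q x|)) = 0` with initial condition `μ₀`.
Smooth test functions on the sphere are the restrictions of smooth functions `φ` on `ℝ^d`; as the
vector field `b` is tangent to the sphere, `⟨∇φ, b⟩ = Dφ(b)` depends only on the restriction. -/
structure IsSolution {d : ℕ} (Q K V : Matrix (Fin d) (Fin d) ℝ)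
    (μ₀ : ProbabilityMeasure (Sph d)) (μ : ℝ → ProbabilityMeasure (Sph d)) : Prop where
  initial : μ 0 = μ₀
  continuousOn : ContinuousOn μ (Ici 0)
  weak : ∀ φ : E d → ℝ, ContDiff ℝ ∞ φ → ∀ t : ℝ, 0 ≤ t →
    ∫ x : Sph d, φ x ∂(μ t : Measure (Sph d)) =
      ∫ x : Sph d, φ x ∂(μ₀ : Measure (Sph d)) +
        ∫ s in (0 : ℝ)..t, ∫ x : Sph d,
          fderiv ℝ φ (x : E d) (field Q K V x) ∂(μ s : Measure (Sph d))

/-- The `ω`-limit set of a curve of probability measures: the weak limits of `μ (t_k)` along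
sequences of times `t_k → ∞`. -/
def omegaLimitSet {d : ℕ} (μ : ℝ → ProbabilityMeasure (Sph d)) :
    Set (ProbabilityMeasure (Sph d)) :=
  {ν | ∃ t : ℕ → ℝ, Tendsto t atTop atTop ∧ Tendsto (fun k => μ (t k)) atTop (𝓝 ν)}

/-- The complexification of a real matrix, as an endomorphism of `ℂ^d`. -/
def complexEnd {d : ℕ} (A : Matrix (Fin d) (Fin d) ℝ) : Module.End ℂ (Fin d → ℂ) :=
  Matrix.toLin' (A.map Complex.ofReal)

/-- `l` is a complex eigenvalue of the real matrix `A` whose real part is the largest. -/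
def IsTopEigenvalue {d : ℕ} (A : Matrix (Fin d) (Fin d) ℝ) (l : ℂ) : Prop :=
  (complexEnd A).HasEigenvalue l ∧ ∀ m : ℂ, (complexEnd A).HasEigenvalue m → m.re ≤ l.re

/-- The inclusion of `ℝ^d` in `ℂ^d`. -/
def complexify (d : ℕ) : E d →ₗ[ℝ] (Fin d → ℂ) where
  toFun x := fun i => (x i : ℂ)
  map_add' x y := by ext i; simp
  map_smul' c x := by ext i; simp

/-- `E_max`: the real vectors in the sum of the complex generalized eigenspaces of `A` for the
eigenvalues with the largest real part. -/
def Emax {d : ℕ} (A : Matrix (Fin d) (Fin d) ℝ) : Submodule ℝ (E d) :=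
  ((⨆ l ∈ {l : ℂ | IsTopEigenvalue A l},
    (complexEnd A).maxGenEigenspace l).restrictScalars ℝ).comap (complexify d)

end Alignment

end

namespace Alignment

/-! Write `A` for `V Kᵀ Q`. Up to a positive scalar and a radial term, the field is the linear field
`A x`, so degree-zero homogeneous functions only see the linear dynamics. Choose quadratic forms
`U`, `W`: along `x' = A x`, `U` grows at rate at least `2b` and `W` at rate at most `2a < 2b`, where
`W = 0` only on `Emax` and `U = 0` only inside a proper subspace (`exists_growth_forms`). Then `f =
W / (U + W)` satisfies the logistic inequality `f' ≤ -c f (1 - f)` (`exists_lyapunov`). No flow is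
needed: testing the weak equation with powers of `f` gives `F_n' ≤ -c (F_n - F_{n+1})` in integrated
form, for the moments `F_n = ∫ f^(n+1) dμ_t`. The moments decrease in time and in `n`, and the
inequality forces all of them to have the same limit, which is at most `F_n(0)`. As `μ₀` does not
charge `{f = 1}`, `F_n(0) → 0` (`tendsto_integral_zero_of_logistic`). Hence `∫ f dν = 0`, and `f`
vanishes on the support of `ν`. -/

/-! ### Quadratic forms adapted to the spectrum -/

/-- A bilinear form adapted to a Jordan-type chain of linear maps. -/
theorem exists_bilinForm_of_chain {F W : Type*} [AddCommGroup F] [Module ℝ F]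
    [NormedAddCommGroup W] [InnerProductSpace ℂ W] (A : F →ₗ[ℝ] F) (L : ℕ → F →ₗ[ℝ] W) (l : ℂ)
    (hL : ∀ k x, L k (A x) = l • L k x + L (k + 1) x) (n : ℕ) (hn : L n = 0)
    {δ : ℝ} (hδ : 0 < δ) :
    ∃ B : LinearMap.BilinForm ℝ F, (∀ x y, B x y = B y x) ∧ (∀ x, 0 ≤ B x x) ∧
      (∀ x, B x x = 0 → L 0 x = 0) ∧
      ∀ x, |B x (A x) - l.re * B x x| ≤ δ * B x x := by
  let _ : InnerProductSpace ℝ W := InnerProductSpace.complexToReal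
  -- Geometric weights make the coupling of levels `k` and `k + 1` small: with this ratio, Young's
  -- inequality bounds it by `δ / 2` times the two weighted squares.
  set c : ℝ := (δ ^ 2)⁻¹ with hc
  have hc0 : 0 < c := by positivity
  let B : LinearMap.BilinForm ℝ F :=
    ∑ k ∈ Finset.range n, c ^ k • (innerₗ W).compl₁₂ (L k) (L k)
  have hB : ∀ x y, B x y = ∑ k ∈ Finset.range n, c ^ k * ⟪L k x, L k y⟫_ℝ := by
    intro x y
    simp [B, LinearMap.sum_apply]
  have hBB : ∀ x, B x x = ∑ k ∈ Finset.range n, c ^ k * ‖L k x‖ ^ 2 := by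
    intro x
    simp only [hB, real_inner_self_eq_norm_sq]
  have hpos : ∀ x, ∀ k ∈ Finset.range n, 0 ≤ c ^ k * ‖L k x‖ ^ 2 := fun x k _ => by positivity
  refine ⟨B, fun x y => ?_, fun x => ?_, fun x hx => ?_, fun x => ?_⟩
  · rw [hB, hB]
    exact Finset.sum_congr rfl fun k _ => by rw [real_inner_comm]
  · rw [hBB]
    exact Finset.sum_nonneg (hpos x)
  · rcases Nat.eq_zero_or_pos n with h0 | h0
    · subst h0
      simp [hn]
    · rw [hBB, Finset.sum_eq_zero_iff_of_nonneg (hpos x)] at hx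
      simpa using hx 0 (Finset.mem_range.2 h0)
  · have h1 : B x (A x) - l.re * B x x =
        ∑ k ∈ Finset.range n, c ^ k * ⟪L k x, L (k + 1) x⟫_ℝ := by
      rw [hB, hBB, Finset.mul_sum, ← Finset.sum_sub_distrib]
      refine Finset.sum_congr rfl fun k _ => ?_
      have h2 : ⟪L k x, l • L k x⟫_ℝ = l.re * ‖L k x‖ ^ 2 := by
        rw [real_inner_eq_re_inner ℂ, inner_smul_right, inner_self_eq_norm_sq_to_K]
        simp [← Complex.ofReal_pow]
      rw [hL, inner_add_right, h2]
      ring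
    have h3 : ∑ k ∈ Finset.range n, c ^ (k + 1) * ‖L (k + 1) x‖ ^ 2 ≤ B x x := by
      have h4 := Finset.sum_range_succ' (fun k => c ^ k * ‖L k x‖ ^ 2) n
      rw [Finset.sum_range_succ, hn] at h4
      simp only [LinearMap.zero_apply, norm_zero] at h4
      have : 0 ≤ c ^ 0 * ‖L 0 x‖ ^ 2 := by positivity
      rw [hBB]
      linarith
    have h5 : ∀ k ∈ Finset.range n, |c ^ k * ⟪L k x, L (k + 1) x⟫_ℝ| ≤
        δ / 2 * (c ^ k * ‖L k x‖ ^ 2 + c ^ (k + 1) * ‖L (k + 1) x‖ ^ 2) := by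
      intro k _
      rw [abs_mul, abs_of_pos (pow_pos hc0 k)]
      have h6 := abs_real_inner_le_norm (L k x) (L (k + 1) x)
      have h7 : ‖L k x‖ * ‖L (k + 1) x‖ ≤ δ / 2 * (‖L k x‖ ^ 2 + c * ‖L (k + 1) x‖ ^ 2) := by
        have h8 : δ / 2 * (‖L k x‖ ^ 2 + c * ‖L (k + 1) x‖ ^ 2) - ‖L k x‖ * ‖L (k + 1) x‖ =
            δ / 2 * (‖L k x‖ - δ⁻¹ * ‖L (k + 1) x‖) ^ 2 := by
          rw [hc]
          field_simp
          ring
        have : 0 ≤ δ / 2 * (‖L k x‖ - δ⁻¹ * ‖L (k + 1) x‖) ^ 2 := by positivity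
        linarith
      calc c ^ k * |⟪L k x, L (k + 1) x⟫_ℝ|
          ≤ c ^ k * (δ / 2 * (‖L k x‖ ^ 2 + c * ‖L (k + 1) x‖ ^ 2)) := by
            gcongr
            exact h6.trans h7
        _ = _ := by ring
    rw [h1]
    calc |∑ k ∈ Finset.range n, c ^ k * ⟪L k x, L (k + 1) x⟫_ℝ|
        ≤ ∑ k ∈ Finset.range n,
          δ / 2 * (c ^ k * ‖L k x‖ ^ 2 + c ^ (k + 1) * ‖L (k + 1) x‖ ^ 2) :=
          (Finset.abs_sum_le_sum_abs _ _).trans (Finset.sum_le_sum h5)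
      _ = δ / 2 * (B x x + ∑ k ∈ Finset.range n, c ^ (k + 1) * ‖L (k + 1) x‖ ^ 2) := by
          rw [← Finset.mul_sum, Finset.sum_add_distrib, hBB]
      _ ≤ δ / 2 * (B x x + B x x) := by gcongr
      _ = δ * B x x := by ring

theorem complexify_toEuclideanLin {d : ℕ} (A : Matrix (Fin d) (Fin d) ℝ) (x : E d) :
    complexify d (Matrix.toEuclideanLin A x) = complexEnd A (complexify d x) := by
  ext i
  simp [complexify, complexEnd, Matrix.mulVec, dotProduct, Matrix.toLpLin_apply]

/-- The spectral decomposition of an endomorphism, in terms of operators commuting with it. -/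
theorem exists_spectral_operators {W : Type*} [AddCommGroup W] [Module ℂ W]
    [FiniteDimensional ℂ W] [Nontrivial W] (T : Module.End ℂ W) :
    ∃ (S : Finset ℂ) (R P : ℂ → Module.End ℂ W) (n : ℂ → ℕ),
      (∀ l, l ∈ S ↔ T.HasEigenvalue l) ∧ (∀ l, Commute T (R l)) ∧
      (∀ l ∈ S, (T - algebraMap ℂ _ l) ^ n l * R l = 0) ∧
      (∀ z, ∑ l ∈ S, P l (R l z) = z) ∧ (∀ l ∈ S, R l ≠ 0) ∧
      ∀ l ∈ S, ∀ z, P l (R l z) ∈ T.maxGenEigenspace l := by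
  classical
  set m := T.charpoly.roots with hm
  set S := m.toFinset with hS
  have hSmem : ∀ l, l ∈ S ↔ T.HasEigenvalue l := fun l => by
    rw [hS, Multiset.mem_toFinset, hm, Polynomial.mem_roots T.charpoly_monic.ne_zero,
      Module.End.hasEigenvalue_iff_isRoot_charpoly]
  let s : ℂ → Polynomial ℂ := fun l => (Polynomial.X - Polynomial.C l) ^ m.count l
  have hprod : ∏ l ∈ S, s l = T.charpoly := by
    rw [← Finset.prod_multiset_map_count]
    exact ((IsAlgClosed.splits T.charpoly).eq_prod_roots_of_monic T.charpoly_monic).symm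
  have hcop : Pairwise fun i j : S => IsCoprime (s i) (s j) := fun i j hij =>
    IsCoprime.pow (Polynomial.isCoprime_X_sub_C_of_isUnit_sub
      (sub_ne_zero.2 (fun h => hij (Subtype.ext h))).isUnit)
  have hne : S.Nonempty := by
    obtain ⟨l, hl⟩ := Module.End.exists_eigenvalue T
    exact ⟨l, (hSmem l).2 hl⟩
  -- Bézout for the primary factors of the characteristic polynomial; evaluated at `T` it becomes
  -- the resolution of the identity `∑ P l * R l = 1`.
  obtain ⟨a, ha⟩ := (exists_sum_eq_one_iff_pairwise_coprime (s := s) hne).2 hcop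
  let r : ℂ → Polynomial ℂ := fun l => ∏ j ∈ S \ {l}, s j
  have hX : ∀ l, Polynomial.aeval T (s l) = (T - algebraMap ℂ _ l) ^ m.count l := fun l => by
    simp [s]
  have hkill : ∀ l ∈ S, (T - algebraMap ℂ _ l) ^ m.count l * Polynomial.aeval T (r l) = 0 := by
    intro l hl
    rw [← hX, ← map_mul]
    have : s l * r l = T.charpoly := by
      rw [← hprod]
      simp only [r]
      rw [← Finset.erase_eq, Finset.mul_prod_erase S s hl]
    rw [this, LinearMap.aeval_self_charpoly]
  refine ⟨S, fun l => Polynomial.aeval T (r l), fun l => Polynomial.aeval T (a l),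
    fun l => m.count l, hSmem, fun l => ?_, hkill, fun z => ?_, fun l hl h => ?_,
    fun l hl z => ?_⟩
  · exact (Polynomial.commute_X _).symm.map (Polynomial.aeval T) |> fun h => by simpa using h.symm
  · have := congrArg (fun p => Polynomial.aeval T p z) ha
    simpa [LinearMap.sum_apply, Module.End.mul_apply, r] using this
  · obtain ⟨v, hv⟩ := ((hSmem l).1 hl).exists_hasEigenvector
    have h1 := Module.End.aeval_apply_of_hasEigenvector (p := r l) hv
    beta_reduce at h
    rw [h, LinearMap.zero_apply] at h1
    have h2 := (smul_eq_zero.1 h1.symm).resolve_right hv.2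
    simp only [r, Polynomial.eval_prod, s, Finset.prod_eq_zero_iff, Polynomial.eval_pow,
      Polynomial.eval_sub, Polynomial.eval_X, Polynomial.eval_C] at h2
    obtain ⟨j, hj, hj0⟩ := h2
    have := eq_zero_of_pow_eq_zero hj0
    simp [sub_eq_zero] at hj this
    exact hj.2 this.symm
  · rw [Module.End.mem_maxGenEigenspace]
    refine ⟨m.count l, ?_⟩
    have hcomm : Commute (Polynomial.aeval T (s l)) (Polynomial.aeval T (a l)) :=
      (Commute.all _ _).map _
    rw [hX] at hcomm
    have h1 := congrArg (fun f : Module.End ℂ W => f (Polynomial.aeval T (r l) z)) hcomm.eq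
    have h2 := congrArg (fun f : Module.End ℂ W => f z) (hkill l hl)
    simp only [Module.End.mul_apply, LinearMap.zero_apply] at h1 h2
    rw [Algebra.algebraMap_eq_smul_one] at h1 h2
    rw [h1, h2, map_zero]

/-- Two quadratic forms that separate the growth rates of `exp (s A)` on and off `Emax A`. -/
theorem exists_growth_forms {d : ℕ} (hd : 0 < d) (A : Matrix (Fin d) (Fin d) ℝ) :
    ∃ (U V : LinearMap.BilinForm ℝ (E d)) (a b : ℝ) (p : Submodule ℝ (E d)), a < b ∧ p ≠ ⊤ ∧
      (∀ x y, U x y = U y x) ∧ (∀ x y, V x y = V y x) ∧ (∀ x, 0 ≤ U x x) ∧ (∀ x, 0 ≤ V x x) ∧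
      (∀ x, x ≠ 0 → 0 < U x x + V x x) ∧ (∀ x, U x x = 0 → x ∈ p) ∧
      (∀ x, V x x = 0 → x ∈ Emax A) ∧
      (∀ x, b * U x x ≤ U x (Matrix.toEuclideanLin A x)) ∧
      (∀ x, V x (Matrix.toEuclideanLin A x) ≤ a * V x x) := by
  classical
  have : Nonempty (Fin d) := ⟨⟨0, hd⟩⟩
  set T := complexEnd A with hT
  obtain ⟨S, R, P, n, hS, hcomm, hkill, hsum, hR, hmem⟩ := exists_spectral_operators T
  have hne : S.Nonempty := by
    obtain ⟨l, hl⟩ := Module.End.exists_eigenvalue T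
    exact ⟨l, (hS l).2 hl⟩
  obtain ⟨l₀, hl₀, hmax⟩ := S.exists_max_image Complex.re hne
  let e : (Fin d → ℂ) ≃ₗ[ℝ] EuclideanSpace ℂ (Fin d) :=
    ((WithLp.linearEquiv 2 ℂ (Fin d → ℂ)).symm).restrictScalars ℝ
  -- The chain `(T - l)^k R l` ends at `k = n l` and needs no Jordan basis.
  let L : ℂ → ℕ → E d →ₗ[ℝ] EuclideanSpace ℂ (Fin d) := fun l k =>
    e.toLinearMap ∘ₗ (((T - algebraMap ℂ _ l) ^ k * R l).restrictScalars ℝ) ∘ₗ complexify d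
  have hLapp : ∀ l k x, L l k x =
      WithLp.toLp 2 (((T - algebraMap ℂ _ l) ^ k * R l) (complexify d x)) := fun _ _ _ => rfl
  have hL : ∀ l k x, L l k (Matrix.toEuclideanLin A x) = l • L l k x + L l (k + 1) x := by
    intro l k x
    rw [hLapp, hLapp, hLapp, complexify_toEuclideanLin, ← WithLp.toLp_smul, ← WithLp.toLp_add]
    congr 1
    have hc : Commute T ((T - algebraMap ℂ _ l) ^ k * R l) :=
      (((Commute.refl T).sub_right (Algebra.commute_algebraMap_right l T)).pow_right k).mul_right
        (hcomm l)
    have h1 := congrArg (fun f : Module.End ℂ _ => f (complexify d x)) hc.eq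
    simp only [Module.End.mul_apply] at h1
    simp only [Module.End.mul_apply, pow_succ', LinearMap.sub_apply,
      Module.algebraMap_end_apply]
    rw [← hT, ← h1]
    abel
  have hL0 : ∀ l k x, L l k x = 0 → ((T - algebraMap ℂ _ l) ^ k * R l) (complexify d x) = 0 := by
    intro l k x h
    rw [hLapp] at h
    simpa using h
  have hgap : ∃ c < l₀.re, ∀ l ∈ S, l.re ≠ l₀.re → l.re ≤ c := by
    rcases (S.filter fun l => l.re ≠ l₀.re).eq_empty_or_nonempty with h | h
    · refine ⟨l₀.re - 1, by linarith, fun l hl hl' => ?_⟩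
      have : l ∈ (S.filter fun l => l.re ≠ l₀.re) := Finset.mem_filter.2 ⟨hl, hl'⟩
      simp [h] at this
    · obtain ⟨m, hm, hm'⟩ := Finset.exists_max_image _ Complex.re h
      rw [Finset.mem_filter] at hm
      exact ⟨m.re, lt_of_le_of_ne (hmax m hm.1) hm.2,
        fun l hl hl' => hm' l (Finset.mem_filter.2 ⟨hl, hl'⟩)⟩
  obtain ⟨c, hc, hgap⟩ := hgap
  -- A third of the spectral gap: perturbing both rates by it still leaves them separated.
  have hδ : 0 < (l₀.re - c) / 3 := by linarith
  have hB : ∀ l : ℂ, ∃ B : LinearMap.BilinForm ℝ (E d), l ∈ S →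
      (∀ x y, B x y = B y x) ∧ (∀ x, 0 ≤ B x x) ∧ (∀ x, B x x = 0 → R l (complexify d x) = 0) ∧
      ∀ x, |B x (Matrix.toEuclideanLin A x) - l.re * B x x| ≤ (l₀.re - c) / 3 * B x x := by
    intro l
    by_cases hl : l ∈ S
    · have hn : L l (n l) = 0 := by
        ext1 x
        rw [hLapp, hkill l hl]
        simp
      obtain ⟨B, h1, h2, h3, h4⟩ := exists_bilinForm_of_chain (Matrix.toEuclideanLin A) (L l) l
        (hL l) (n l) hn hδ
      exact ⟨B, fun _ => ⟨h1, h2, fun x hx => by simpa using hL0 l 0 x (h3 x hx), h4⟩⟩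
    · exact ⟨0, fun h => absurd h hl⟩
  choose B hB using hB
  let top := S.filter fun l => l.re = l₀.re
  let rest := S.filter fun l => l.re ≠ l₀.re
  have htop : ∀ l ∈ top, l ∈ S ∧ l.re = l₀.re := fun l hl => Finset.mem_filter.1 hl
  have hrest : ∀ l ∈ rest, l ∈ S ∧ l.re ≠ l₀.re := fun l hl => Finset.mem_filter.1 hl
  have hU0 : ∀ x, (∑ l ∈ top, B l x x) = 0 → ∀ l ∈ top, R l (complexify d x) = 0 := by
    intro x hx l hl
    rw [Finset.sum_eq_zero_iff_of_nonneg fun l hl => (hB l (htop l hl).1).2.1 x] at hx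
    exact (hB l (htop l hl).1).2.2.1 x (hx l hl)
  have hV0 : ∀ x, (∑ l ∈ rest, B l x x) = 0 → ∀ l ∈ rest, R l (complexify d x) = 0 := by
    intro x hx l hl
    rw [Finset.sum_eq_zero_iff_of_nonneg fun l hl => (hB l (hrest l hl).1).2.1 x] at hx
    exact (hB l (hrest l hl).1).2.2.1 x (hx l hl)
  have hUnn : ∀ x, 0 ≤ ∑ l ∈ top, B l x x := fun x =>
    Finset.sum_nonneg fun l hl => (hB l (htop l hl).1).2.1 x
  have hVnn : ∀ x, 0 ≤ ∑ l ∈ rest, B l x x := fun x =>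
    Finset.sum_nonneg fun l hl => (hB l (hrest l hl).1).2.1 x
  have hsplit : ∀ z, ∑ l ∈ top, P l (R l z) + ∑ l ∈ rest, P l (R l z) = z := fun z => by
    rw [← hsum z]
    simp only [top, rest]
    rw [Finset.sum_filter_add_sum_filter_not]
    simp only [hsum]
  refine ⟨∑ l ∈ top, B l, ∑ l ∈ rest, B l, c + (l₀.re - c) / 3, l₀.re - (l₀.re - c) / 3,
    LinearMap.ker ((R l₀).restrictScalars ℝ ∘ₗ complexify d), by linarith, ?_, ?_⟩
  -- The real vectors span `ℂ^d` over `ℂ`, so `R l₀` would vanish if it killed all of them.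
  · intro h
    rw [LinearMap.ker_eq_top] at h
    apply hR l₀ hl₀
    refine LinearMap.pi_ext' fun i => ?_
    ext1
    have h1 := congrArg (fun f : E d →ₗ[ℝ] (Fin d → ℂ) => f (EuclideanSpace.single i 1)) h
    have h2 : complexify d (EuclideanSpace.single i 1) = Pi.single i 1 := by
      ext j
      by_cases hj : j = i
      · subst hj
        simp [complexify]
      · simp [complexify, hj]
    simpa [h2] using h1
  simp only [LinearMap.sum_apply]
  refine ⟨fun x y => Finset.sum_congr rfl fun l hl => (hB l (htop l hl).1).1 x y,
    fun x y => Finset.sum_congr rfl fun l hl => (hB l (hrest l hl).1).1 x y, hUnn, hVnn,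
    fun x hx => ?_, fun x hx => ?_, fun x hx => ?_, fun x => ?_, fun x => ?_⟩
  · refine lt_of_le_of_ne (add_nonneg (hUnn x) (hVnn x)) fun h => hx ?_
    have h1 := hU0 x (by linarith [hUnn x, hVnn x])
    have h2 := hV0 x (by linarith [hUnn x, hVnn x])
    have h3 := hsplit (complexify d x)
    rw [Finset.sum_eq_zero fun l hl => by rw [h1 l hl, map_zero],
      Finset.sum_eq_zero fun l hl => by rw [h2 l hl, map_zero], add_zero] at h3
    ext i
    simpa [complexify] using (congrFun h3 i).symm
  · exact hU0 x hx l₀ (Finset.mem_filter.2 ⟨hl₀, rfl⟩)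
  · have h2 := hV0 x hx
    have h3 := hsplit (complexify d x)
    rw [Finset.sum_eq_zero (s := rest) fun l hl => by rw [h2 l hl, map_zero], add_zero] at h3
    change complexify d x ∈ (⨆ l ∈ {l : ℂ | IsTopEigenvalue A l}, T.maxGenEigenspace l)
    rw [← h3]
    refine Submodule.sum_mem _ fun l hl => ?_
    refine (le_iSup₂_of_le (f := fun l (_ : l ∈ {l : ℂ | IsTopEigenvalue A l}) =>
      T.maxGenEigenspace l) l ?_ le_rfl) (hmem l (htop l hl).1 _)
    refine ⟨(hS l).1 (htop l hl).1, fun m hm => ?_⟩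
    rw [(htop l hl).2]
    exact hmax m ((hS m).2 hm)
  · rw [Finset.mul_sum]
    refine Finset.sum_le_sum fun l hl => ?_
    have h1 := (abs_le.1 ((hB l (htop l hl).1).2.2.2 x)).1
    rw [(htop l hl).2] at h1
    linarith
  · rw [Finset.mul_sum]
    refine Finset.sum_le_sum fun l hl => ?_
    have h1 := (abs_le.1 ((hB l (hrest l hl).1).2.2.2 x)).2
    have h2 := mul_le_mul_of_nonneg_right (hgap l (hrest l hl).1 (hrest l hl).2)
      ((hB l (hrest l hl).1).2.1 x)
    linarith

/-! ### The Lyapunov function on the sphere -/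

theorem toEuclideanLin_ne_zero {d : ℕ} {M : Matrix (Fin d) (Fin d) ℝ} (hM : IsUnit M) {x : E d}
    (hx : x ≠ 0) : Matrix.toEuclideanLin M x ≠ 0 := by
  intro h
  apply hx
  have h1 : M.mulVec x.ofLp = M.mulVec 0 := by
    rw [Matrix.toLpLin_apply] at h
    simpa using h
  have := Matrix.mulVec_injective_of_isUnit hM h1
  ext i
  simpa using congrFun this i

theorem continuous_field {d : ℕ} {Q K : Matrix (Fin d) (Fin d) ℝ} (V : Matrix (Fin d) (Fin d) ℝ)
    (hM : IsUnit (K.transpose * Q)) : Continuous fun x : Sph d => field Q K V x := by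
  have h1 : ∀ M : Matrix (Fin d) (Fin d) ℝ,
      Continuous fun x : Sph d => Matrix.toEuclideanLin M (x : E d) := fun M =>
    (LinearMap.continuous_of_finiteDimensional _).comp continuous_subtype_val
  have h2 : Continuous fun x : Sph d => ‖Matrix.toEuclideanLin (K.transpose * Q) (x : E d)‖⁻¹ •
      Matrix.toEuclideanLin (V * K.transpose * Q) (x : E d) :=
    ((h1 _).norm.inv₀ fun x => norm_ne_zero_iff.2
      (toEuclideanLin_ne_zero hM (ne_zero_of_mem_unit_sphere x))).smul (h1 _)
  exact h2.sub ((continuous_subtype_val.inner (𝕜 := ℝ) h2).smul continuous_subtype_val)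

/-- A smooth Lyapunov function separating `Emax A` from its spectral complement. -/
theorem exists_lyapunov {d : ℕ} (hd : 0 < d) {Q K : Matrix (Fin d) (Fin d) ℝ}
    (V : Matrix (Fin d) (Fin d) ℝ) (hM : IsUnit (K.transpose * Q)) :
    ∃ (f : E d → ℝ) (c : ℝ) (p : Submodule ℝ (E d)), ContDiff ℝ ∞ f ∧ 0 < c ∧ p ≠ ⊤ ∧
      (∀ x : Sph d, 0 ≤ f x) ∧ (∀ x : Sph d, f x ≤ 1) ∧
      (∀ x : Sph d, f x = 0 → (x : E d) ∈ Emax (V * K.transpose * Q)) ∧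
      (∀ x : Sph d, f x = 1 → (x : E d) ∈ p) ∧
      ∀ x : Sph d, fderiv ℝ f x (field Q K V x) ≤ -c * (f x * (1 - f x)) := by
  obtain ⟨U, W, a, b, p, hab, hp, hUs, hWs, hU, hW, hUW, hUp, hWE, hUb, hWa⟩ :=
    exists_growth_forms hd (V * K.transpose * Q)
  set A := Matrix.toEuclideanLin (V * K.transpose * Q)
  set M := LinearMap.toContinuousLinearMap (Matrix.toEuclideanLin (K.transpose * Q))
  -- Added to the denominator, this bump removes the singularity at the origin, so that `f` is a
  -- smooth test function on all of `ℝ^d`; it vanishes near the sphere.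
  let g : ContDiffBump (0 : E d) := ⟨1 / 4, 1 / 2, by norm_num, by norm_num⟩
  have hsm : ∀ B : LinearMap.BilinForm ℝ (E d), ContDiff ℝ ∞ fun x => B x x := fun B =>
    B.toContinuousBilinearMap.isBoundedBilinearMap.contDiff.comp (contDiff_id.prodMk contDiff_id)
  have hder : ∀ B : LinearMap.BilinForm ℝ (E d), (∀ x y, B x y = B y x) → ∀ x,
      HasFDerivAt (fun x => B x x) ((2 : ℝ) • B.toContinuousBilinearMap x) x := by
    intro B hB x
    have h1 := B.toContinuousBilinearMap.hasFDerivAt_of_bilinear (hasFDerivAt_id x)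
      (hasFDerivAt_id x)
    refine h1.congr_fderiv ?_
    ext y
    simp [hB y x]
    ring
  have hgne : ∀ x, 0 < U x x + W x x + g x := by
    intro x
    by_cases hx : x = 0
    · have : g x = 1 := by
        rw [hx]
        exact g.one_of_mem_closedBall (Metric.mem_closedBall_self (by norm_num [g]))
      linarith [hU x, hW x]
    · linarith [hUW x hx, g.nonneg' x]
  have hg0 : ∀ x : Sph d, ∀ᶠ y in 𝓝 (x : E d), g y = 0 := by
    intro x
    have h1 : ∀ᶠ y in 𝓝 (x : E d), (1 / 2 : ℝ) < ‖y‖ :=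
      continuous_norm.continuousAt.eventually (lt_mem_nhds (by
        simp only [norm_eq_of_mem_sphere]
        norm_num))
    filter_upwards [h1] with y hy
    exact g.zero_of_le_dist (by
      rw [dist_zero_right]
      exact hy.le)
  have hpos : ∀ x : Sph d, 0 < U x x + W x x := fun x => hUW x (ne_zero_of_mem_unit_sphere x)
  let f : E d → ℝ := fun x => W x x / (U x x + W x x + g x)
  have hfx : ∀ x : Sph d, f x = W x x / (U x x + W x x) := fun x => by
    simp only [f, (hg0 x).self_of_nhds, add_zero]
  refine ⟨f, 2 * (b - a) / (‖M‖ + 1), p, ?_, ?_, hp, fun x => ?_, fun x => ?_, fun x hx => ?_,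
    fun x hx => ?_, fun x => ?_⟩
  · exact (hsm W).div (((hsm U).add (hsm W)).add g.contDiff) fun x => (hgne x).ne'
  · have := norm_nonneg M
    have : 0 < b - a := by linarith
    positivity
  · rw [hfx]
    exact div_nonneg (hW x) (hpos x).le
  · rw [hfx, div_le_one (hpos x)]
    linarith [hU x]
  · rw [hfx, div_eq_zero_iff] at hx
    exact hWE x (hx.resolve_right (hpos x).ne')
  · rw [hfx, div_eq_one_iff_eq (hpos x).ne'] at hx
    exact hUp x (by linarith)
  · have hfe : f =ᶠ[𝓝 (x : E d)] fun x => W x x / (U x x + W x x) := by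
      filter_upwards [hg0 x] with y hy
      simp only [f, hy, add_zero]
    have h1 := (hder W hWs x).mul ((hasDerivAt_inv (hpos x).ne').comp_hasFDerivAt (x : E d)
      ((hder U hUs x).add (hder W hWs x)))
    have h2 := (h1.congr_of_eventuallyEq hfe).fderiv
    rw [h2, hfx]
    have hMx : 0 < ‖M x‖ := norm_pos_iff.2 (toEuclideanLin_ne_zero hM (ne_zero_of_mem_unit_sphere x))
    have hMle : ‖M x‖ ≤ ‖M‖ + 1 := by
      have := M.le_opNorm x
      rw [norm_eq_of_mem_sphere] at this
      linarith
    have hfield : field Q K V x =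
        ‖M x‖⁻¹ • A x - (‖M x‖⁻¹ * ⟪(x : E d), A x⟫_ℝ) • (x : E d) := by
      rw [field, tangentProj, inner_smul_right]
      rfl
    rw [hfield]
    have hα : (‖M‖ + 1)⁻¹ ≤ ‖M x‖⁻¹ := inv_anti₀ hMx hMle
    have hu := hU x
    have hw := hW x
    have hs := hpos x
    have hub := hUb x
    have hwa := hWa x
    simp only [smul_apply, add_apply, Function.comp_apply, Pi.add_apply, LinearMap.toContinuousBilinearMap_apply, smul_eq_mul,
      map_sub, map_smul]
    set u := U x x
    set w := W x x
    set α := ‖M x‖⁻¹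
    set s := ⟪(x : E d), A x⟫_ℝ
    set u' := U x (A x)
    set w' := W x (A x)
    have h5 : 0 ≤ (b - a) * (u * w) := mul_nonneg (by linarith) (mul_nonneg hu hw)
    have h3 : u * w' - w * u' ≤ -((b - a) * (u * w)) := by
      nlinarith [mul_le_mul_of_nonneg_left hwa hu, mul_le_mul_of_nonneg_left hub hw]
    have hα0 : 0 < α := inv_pos.2 hMx
    have h4 : α * (u * w' - w * u') ≤ -((‖M‖ + 1)⁻¹ * ((b - a) * (u * w))) := by
      nlinarith [mul_le_mul_of_nonneg_left h3 hα0.le, mul_le_mul_of_nonneg_right hα h5]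
    have h6 : -(2 * (b - a) / (‖M‖ + 1)) * (w / (u + w) * (1 - w / (u + w))) =
        2 * -((‖M‖ + 1)⁻¹ * ((b - a) * (u * w))) / (u + w) ^ 2 := by
      have : ‖M‖ + 1 ≠ 0 := by positivity
      field_simp
      ring
    rw [h6]
    -- The radial terms in `s` cancel because `u` and `w` are both quadratic.
    calc _ = 2 * (α * (u * w' - w * u')) / (u + w) ^ 2 := by
          field_simp
          ring
      _ ≤ _ := by gcongr

/-- The surface measure is a multiple of the volume of the cone over the set, and this cone stays
inside the null set `p`. -/
theorem surfaceMeasure_submodule {d : ℕ} {p : Submodule ℝ (E d)} (hp : p ≠ ⊤) :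
    surfaceMeasure d {x : Sph d | (x : E d) ∈ p} = 0 := by
  have hmeas : MeasurableSet {x : Sph d | (x : E d) ∈ p} :=
    (p.closed_of_finiteDimensional.preimage continuous_subtype_val).measurableSet
  rw [surfaceMeasure, Measure.toSphere_apply' _ hmeas]
  refine mul_eq_zero_of_right _ (measure_mono_null ?_ (Measure.addHaar_submodule volume p hp))
  rintro _ ⟨r, -, _, ⟨x, hx, rfl⟩, rfl⟩
  exact p.smul_mem r hx

/-! ### Decay of moments -/

/-- Continuity of the integral of a continuous function along a curve of measures. -/
theorem continuousOn_integral {X : Type*} [TopologicalSpace X] [CompactSpace X]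
    [MeasurableSpace X] [BorelSpace X] {μ : ℝ → ProbabilityMeasure X} {s : Set ℝ}
    (hμ : ContinuousOn μ s) {g : X → ℝ} (hg : Continuous g) :
    ContinuousOn (fun t => ∫ x, g x ∂(μ t : Measure X)) s := fun t ht =>
  ProbabilityMeasure.tendsto_iff_forall_integral_tendsto.1 (hμ t ht)
    (BoundedContinuousFunction.mkOfCompact ⟨g, hg⟩)

theorem integrable_of_continuous {X : Type*} [TopologicalSpace X] [CompactSpace X]
    [MeasurableSpace X] [BorelSpace X] (μ : Measure X) [IsFiniteMeasure μ] {g : X → ℝ}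
    (hg : Continuous g) : Integrable g μ :=
  (BoundedContinuousFunction.mkOfCompact ⟨g, hg⟩).integrable μ

/-- If the moments of a `[0, 1]`-valued observable satisfy the logistic dissipation inequality along
a curve of probability measures, and initially the observable is a.e. less than one, then its mean
tends to zero. -/
theorem tendsto_integral_zero_of_logistic {X : Type*} [TopologicalSpace X] [CompactSpace X]
    [MeasurableSpace X] [BorelSpace X] {μ : ℝ → ProbabilityMeasure X}
    (hμ : ContinuousOn μ (Ici 0)) {f : X → ℝ} (hf : Continuous f) (h0 : ∀ x, 0 ≤ f x)
    (h1 : ∀ x, f x ≤ 1) (hae : ∀ᵐ x ∂(μ 0 : Measure X), f x ≠ 1) {c : ℝ} (hc : 0 < c)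
    (hdiss : ∀ n : ℕ, ∀ s t : ℝ, 0 ≤ s → s ≤ t →
      ∫ x, f x ^ (n + 1) ∂(μ t : Measure X) - ∫ x, f x ^ (n + 1) ∂(μ s : Measure X) ≤
        -c * ∫ r in s..t, (∫ x, f x ^ (n + 1) ∂(μ r : Measure X) -
          ∫ x, f x ^ (n + 2) ∂(μ r : Measure X))) :
    Tendsto (fun t => ∫ x, f x ∂(μ t : Measure X)) atTop (𝓝 0) := by
  let F : ℕ → ℝ → ℝ := fun n t => ∫ x, f x ^ (n + 1) ∂(μ t : Measure X)
  have hint : ∀ n t, Integrable (fun x => f x ^ n) (μ t : Measure X) := fun n t =>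
    integrable_of_continuous _ (hf.pow n)
  have hFcont : ∀ n, ContinuousOn (F n) (Ici 0) := fun n => continuousOn_integral hμ (hf.pow _)
  have hF0 : ∀ n t, 0 ≤ F n t := fun n t => integral_nonneg fun x => pow_nonneg (h0 x) _
  have hFsucc : ∀ n t, F (n + 1) t ≤ F n t := fun n t =>
    integral_mono (hint _ t) (hint _ t) fun x => pow_le_pow_of_le_one (h0 x) (h1 x) (by lia)
  have hanti : ∀ n s t, 0 ≤ s → s ≤ t → F n t ≤ F n s := by
    intro n s t hs hst
    have h2 := hdiss n s t hs hst
    have h3 : 0 ≤ ∫ r in s..t, (F n r - F (n + 1) r) :=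
      intervalIntegral.integral_nonneg hst fun r _ => sub_nonneg.2 (hFsucc n r)
    have h4 : 0 ≤ c * ∫ r in s..t, (F n r - F (n + 1) r) := by positivity
    change F n t - F n s ≤ -c * ∫ r in s..t, (F n r - F (n + 1) r) at h2
    linarith
  have hstep : ∀ n t, 0 ≤ t → F n (t + 1) - F n t ≤ -c * (F n (t + 1) - F (n + 1) t) := by
    intro n t ht
    refine (hdiss n t (t + 1) ht (by linarith)).trans ?_
    -- Both moments decrease in time, so the integrand is smallest with `F n` at the right end and
    -- `F (n + 1)` at the left end.
    have h2 : ∫ _ in t..(t + 1), (F n (t + 1) - F (n + 1) t) ≤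
        ∫ r in t..(t + 1), (F n r - F (n + 1) r) := by
      refine intervalIntegral.integral_mono_on (by linarith) intervalIntegrable_const ?_ ?_
      · refine ContinuousOn.intervalIntegrable_of_Icc (by linarith) ?_
        exact ((hFcont n).sub (hFcont (n + 1))).mono fun r hr => ht.trans hr.1
      · intro r hr
        exact sub_le_sub (hanti n r (t + 1) (ht.trans hr.1) hr.2) (hanti (n + 1) t r ht hr.1)
    rw [intervalIntegral.integral_const, add_sub_cancel_left, one_smul] at h2
    change -c * ∫ r in t..(t + 1), (F n r - F (n + 1) r) ≤ _
    nlinarith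
  have hlim : ∀ n, ∃ G, Tendsto (F n) atTop (𝓝 G) := by
    intro n
    have hA : Antitone fun t => F n (max t 0) := fun s t hst =>
      hanti n _ _ (le_max_right _ _) (max_le_max_right 0 hst)
    refine ⟨_, (tendsto_atTop_ciInf hA ⟨0, ?_⟩).congr' ?_⟩
    · rintro _ ⟨t, rfl⟩
      exact hF0 _ _
    · filter_upwards [eventually_ge_atTop 0] with t ht
      rw [max_eq_left ht]
  choose G hG using hlim
  have hGsucc : ∀ n, G n ≤ G (n + 1) := by
    intro n
    have hs : Tendsto (fun t => F n (t + 1)) atTop (𝓝 (G n)) :=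
      (hG n).comp (tendsto_atTop_add_const_right _ 1 tendsto_id)
    -- In the limit, `hstep` reads `0 ≤ -c * (G n - G (n + 1))`.
    have h2 := le_of_tendsto_of_tendsto (hs.sub (hG n)) ((hs.sub (hG (n + 1))).const_mul (-c))
      ((eventually_ge_atTop 0).mono fun t ht => hstep n t ht)
    nlinarith
  have hG0 : ∀ n, G 0 ≤ G n := fun n => monotone_nat_of_le_succ hGsucc (Nat.zero_le n)
  have hGle : ∀ n, G n ≤ F n 0 := fun n =>
    le_of_tendsto (hG n) ((eventually_ge_atTop 0).mono fun t ht => hanti n 0 t le_rfl ht)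
  have hF00 : Tendsto (fun n => F n 0) atTop (𝓝 0) := by
    have h2 : Tendsto (fun n => F n 0) atTop (𝓝 (∫ _, (0 : ℝ) ∂(μ 0 : Measure X))) := by
      refine tendsto_integral_of_dominated_convergence (fun _ => 1)
        (fun n => (hint _ 0).aestronglyMeasurable) (integrable_const _) (fun n => ?_) ?_
      · refine Eventually.of_forall fun x => ?_
        rw [Real.norm_of_nonneg (pow_nonneg (h0 x) _)]
        exact pow_le_one₀ (h0 x) (h1 x)
      · filter_upwards [hae] with x hx
        exact (tendsto_pow_atTop_nhds_zero_of_lt_one (h0 x) (lt_of_le_of_ne (h1 x) hx)).comp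
          (tendsto_add_atTop_nat 1)
    simpa using h2
  have hGz : G 0 = 0 := le_antisymm
    (ge_of_tendsto' hF00 fun n => (hG0 n).trans (hGle n)) (ge_of_tendsto' (hG 0) (hF0 0))
  simpa [F, hGz] using hG 0

/-- A nonnegative continuous function with zero integral vanishes on the support. -/
theorem eq_zero_of_mem_support {X : Type*} [TopologicalSpace X] [MeasurableSpace X]
    {ν : Measure X} {f : X → ℝ} (hf : Continuous f) (hfi : Integrable f ν)
    (h0 : ∀ x, 0 ≤ f x) (hν : ∫ x, f x ∂ν = 0) {x : X} (hx : x ∈ ν.support) : f x = 0 := by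
  by_contra h
  have h1 := (integral_eq_zero_iff_of_nonneg h0 hfi).1 hν
  exact ((Measure.mem_support_iff_forall x).1 hx _
    ((isOpen_ne.preimage hf).mem_nhds h)).ne' (ae_iff.1 h1)

end Alignment

/-! ### The limit measures -/

theorem mainTheorem3 {d : ℕ} (Q K V : Matrix (Fin d) (Fin d) ℝ)
    (hQ : IsUnit Q) (hK : IsUnit K)
    (μ₀ : ProbabilityMeasure (Alignment.Sph d))
    (hμ₀ : (μ₀ : Measure (Alignment.Sph d)) ≪ Alignment.surfaceMeasure d)
    (μ : ℝ → ProbabilityMeasure (Alignment.Sph d))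
    (hμ : Alignment.IsSolution Q K V μ₀ μ)
    (ν : ProbabilityMeasure (Alignment.Sph d))
    (hν : ν ∈ Alignment.omegaLimitSet μ) :
    Subtype.val '' (ν : Measure (Alignment.Sph d)).support ⊆
      (Alignment.Emax (V * K.transpose * Q) : Set (Alignment.E d)) ∩
        Metric.sphere (0 : Alignment.E d) 1 := by
  open Alignment in
  rintro _ ⟨x, hx, rfl⟩
  refine ⟨?_, x.2⟩
  have hd : 0 < d := by
    rcases Nat.eq_zero_or_pos d with rfl | h
    · exact absurd (Subsingleton.elim (x : E 0) 0) (ne_zero_of_mem_unit_sphere x)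
    · exact h
  have hM : IsUnit (K.transpose * Q) := ((Matrix.isUnit_transpose K).2 hK).mul hQ
  obtain ⟨f, c, p, hfs, hc, hp, hf0, hf1, hfE, hfp, hfd⟩ := exists_lyapunov hd V hM
  have hf : Continuous fun x : Sph d => f x := hfs.continuous.comp continuous_subtype_val
  have hfpow : ∀ k, Continuous fun x : Sph d => f x ^ k := fun k => hf.pow k
  have hlim : Tendsto (fun t => ∫ x : Sph d, f x ∂(μ t : Measure (Sph d))) atTop (𝓝 0) := by
    refine tendsto_integral_zero_of_logistic hμ.continuousOn hf hf0 hf1 ?_ hc ?_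
    · rw [hμ.initial]
      refine hμ₀.ae_le (measure_mono_null (fun x hx => ?_) (surfaceMeasure_submodule hp))
      exact hfp x (by simpa using hx)
    · intro n s t hs hst
      have hg : ContDiff ℝ ∞ fun y => f y ^ (n + 1) := hfs.pow _
      have hgc : Continuous fun x : Sph d =>
          fderiv ℝ (fun y => f y ^ (n + 1)) (x : E d) (field Q K V x) :=
        ((hg.continuous_fderiv (by simp)).comp continuous_subtype_val).clm_apply
          (continuous_field V hM)
      have hD := continuousOn_integral hμ.continuousOn hgc
      have hi : ∀ r, 0 ≤ r → IntervalIntegrable (fun r => ∫ x : Sph d,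
          fderiv ℝ (fun y => f y ^ (n + 1)) (x : E d) (field Q K V x) ∂(μ r : Measure (Sph d)))
          volume 0 r := fun r hr =>
        (hD.mono fun q hq => hq.1).intervalIntegrable_of_Icc hr
      rw [hμ.weak _ hg t (hs.trans hst), hμ.weak _ hg s hs, add_sub_add_left_eq_sub,
        intervalIntegral.integral_interval_sub_left (hi t (hs.trans hst)) (hi s hs),
        ← intervalIntegral.integral_const_mul]
      refine intervalIntegral.integral_mono_on hst ?_ ?_ fun r hr => ?_
      · exact (hD.mono fun q hq => hs.trans hq.1).intervalIntegrable_of_Icc hst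
      · refine ContinuousOn.intervalIntegrable_of_Icc hst (ContinuousOn.mono ?_
          fun q (hq : q ∈ Icc s t) => hs.trans hq.1)
        exact ((continuousOn_integral hμ.continuousOn (hfpow _)).sub
          (continuousOn_integral hμ.continuousOn (hfpow _))).const_mul _
      · rw [← integral_sub (integrable_of_continuous _ (hfpow _))
          (integrable_of_continuous _ (hfpow _)), ← integral_const_mul]
        refine integral_mono (integrable_of_continuous _ hgc) (integrable_of_continuous _
          (((hfpow _).sub (hfpow _)).const_mul _)) fun y => ?_
        have h1 := ((hfs.differentiable (by simp)) (y : E d)).hasFDerivAt.pow (n + 1)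
        have h2 := hfd y
        have h3 : fderiv ℝ (fun y => f y ^ (n + 1)) (y : E d) (field Q K V y) =
            (n + 1) * f y ^ n * fderiv ℝ f y (field Q K V y) := by
          rw [h1.fderiv]
          simp
        beta_reduce
        rw [h3]
        have hz : 0 ≤ f y * (1 - f y) := mul_nonneg (hf0 y) (by linarith [hf1 y])
        have hk : 0 ≤ f y ^ n := pow_nonneg (hf0 y) n
        have h4 : (n + 1) * f y ^ n * fderiv ℝ f y (field Q K V y) ≤
            (n + 1) * f y ^ n * (-c * (f y * (1 - f y))) := by gcongr
        -- Differentiating the power gives a factor `n + 1`; one copy suffices and the other `n`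
        -- have a favourable sign.
        have h5 : 0 ≤ n * (c * (f y ^ n * (f y * (1 - f y)))) := by positivity
        calc _ ≤ _ := h4
          _ = -c * (f y ^ (n + 1) - f y ^ (n + 2)) -
              n * (c * (f y ^ n * (f y * (1 - f y)))) := by ring
          _ ≤ _ := by linarith
  obtain ⟨t, ht, htν⟩ := hν
  have h1 := ProbabilityMeasure.tendsto_iff_forall_integral_tendsto.1 htν
    (BoundedContinuousFunction.mkOfCompact ⟨_, hf⟩)
  exact hfE x (eq_zero_of_mem_support hf (integrable_of_continuous _ hf) hf0
    (tendsto_nhds_unique h1 (hlim.comp ht)) hx)
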